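/- **Setting.** Let $n\ge 0$, let $K\in L^1(\mathbb{R}^n)$ be a real-valued kernel and let $G:\mathbb{R}\to\mathbb{R}$ be bounded and Lipschitz. Let $M=\mathcal{B}(\mathbb{R}^n,[0,1])$ be the set of Lebesgue measurable functions $f:\mathbb{R}^n\to[0,1]$ (functions, not classes), with the metric $d_\infty(f,g)=\sup_x|f(x)-g(x)|$. The Lenia arc field on $M$ is $$X_h(f)(x)=\min\bigl\{\max\{f(x)+h\,G((K*f)(x)),\,0\},\,1\bigr\},\qquad (K*f)(x)=\int_{\mathbb{R}^n}K(x-y)f(y)\,dy .$$ The Lenia flow is the forward flow $F$ on $M$ (that is, $(t,f)\mapsto F_t(f)$ is continuous on $[0,\infty)\times M$, $F_0(f)=f$ and $F_t(F_s(f))=F_{s+t}(f)$) that is forward tangent to $X$: $$\lim_{h\to0^+}\frac{d_\infty\bigl(F_{t+h}(f),X_h(F_t(f))\bigr)}{h}=0\quad\text{for all } t\ge 0,\ f\in M .$$ For $f_0\in M$ the Lenia solution with initial condition $f_0$ is $f_t:=F_t(f_0)$. **Proposition (finite propagation speed of the support).** Assume that there is $a>0$ such that $G(u)\le 0$ whenever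 $|u|\le a$, let $g>0$ be a finite upper bound for $G$, and assume that $K$ vanishes outside the open Euclidean ball $B(0,R)\subseteq\mathbb{R}^n$ of radius $R>0$. For $x\in\mathbb{R}^n$ let $$d(x):=\inf\{\|x-y\|_2 : y\in\operatorname{supp}(f_0)\}\in[0,\infty]$$ be the distance from $x$ to the support of $f_0$ (with $d(x)=\infty$ if $f_0=0$). Then $$f_t(x)=0\qquad\text{for every } t \text{ with } 0<t\le\frac{a\lfloor d(x)/R\rfloor}{g\,\|K\|_1}.$$ Here the bound is computed in $[0,\infty]$, with $\lfloor\infty\rfloor=\infty$ and, if $\|K\|_1=0$, with $k/0=\infty$ for $k>0$ and $0/0=0$. -/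

import Mathlib

open MeasureTheory Filter Topology
open scoped NNReal ENNReal

/-! ## Forward flows on metric spaces -/

/-- A forward flow on a metric space `M`: a jointly continuous map `(t, f) ↦ F t f`, for `t ≥ 0`,
with `F 0 f = f` and `F t (F s f) = F (s + t) f`. -/
structure IsForwardFlow {M : Type*} [MetricSpace M] (F : ℝ≥0 → M → M) : Prop where
  continuous : Continuous (fun p : ℝ≥0 × M => F p.1 p.2)
  zero : ∀ f : M, F 0 f = f
  add : ∀ (s t : ℝ≥0) (f : M), F t (F s f) = F (s + t) f

/-- `F` is forward tangent to the arc field `X`: for all `t ≥ 0` and all `f`,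
`d (F_{t+h} f, X_h (F_t f)) / h → 0` as `h → 0⁺`. Only the values of `X` at times `h` close to `0`
matter. -/
def IsForwardTangent {M : Type*} [MetricSpace M] (F X : ℝ≥0 → M → M) : Prop :=
  ∀ (t : ℝ≥0) (f : M),
    Tendsto (fun h : ℝ≥0 => dist (F (t + h) f) (X h (F t f)) / (h : ℝ)) (𝓝[>] 0) (𝓝 0)

/-! ## The state space of Lenia -/

/-- The set `𝓑(ℝⁿ, [0,1])` of Lebesgue measurable functions on Euclidean `n`-space with values in
`[0,1]`: genuine functions, not classes up to null sets. (`NullMeasurable f volume` is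
measurability for the completion of the Borel sigma-algebra under Lebesgue measure.) -/
structure LeniaState (n : ℕ) where
  toFun : EuclideanSpace ℝ (Fin n) → ℝ
  nullMeasurable' : NullMeasurable toFun volume
  mem_Icc' : ∀ x, toFun x ∈ Set.Icc (0 : ℝ) 1

namespace LeniaState

variable {n : ℕ}

instance : CoeFun (LeniaState n) (fun _ => EuclideanSpace ℝ (Fin n) → ℝ) := ⟨toFun⟩

@[ext] theorem ext {f g : LeniaState n} (h : ∀ x, f x = g x) : f = g := by
  cases f
  cases g
  congr
  exact funext h

theorem abs_sub_le_one (f g : LeniaState n) (x : EuclideanSpace ℝ (Fin n)) :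
    |f x - g x| ≤ 1 := by
  have hf := f.mem_Icc' x
  have hg := g.mem_Icc' x
  rw [abs_le]
  constructor <;> linarith [hf.1, hf.2, hg.1, hg.2]

theorem bddAbove_abs_sub (f g : LeniaState n) :
    BddAbove (Set.range fun x => |f x - g x|) := by
  refine ⟨1, ?_⟩
  rintro _ ⟨x, rfl⟩
  exact abs_sub_le_one f g x

/-- The supremum metric `d_∞(f, g) = sup_x |f x - g x|`. -/
noncomputable instance : MetricSpace (LeniaState n) where
  dist f g := ⨆ x, |f x - g x|
  dist_self f := by simp
  dist_comm f g := by simp only [abs_sub_comm]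
  dist_triangle f g h := by
    refine ciSup_le fun x => ?_
    exact (abs_sub_le (f x) (g x) (h x)).trans
      (add_le_add (le_ciSup (bddAbove_abs_sub f g) x) (le_ciSup (bddAbove_abs_sub g h) x))
  eq_of_dist_eq_zero := by
    intro f g h
    refine ext fun x => ?_
    have h1 : |f x - g x| ≤ 0 := h ▸ le_ciSup (bddAbove_abs_sub f g) x
    exact sub_eq_zero.mp (abs_nonpos_iff.mp h1)

theorem dist_def (f g : LeniaState n) : dist f g = ⨆ x, |f x - g x| := rfl

end LeniaState

/-! ## The Lenia arc field and its flow -/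

/-- The convolution `(K ∗ f)(x) = ∫ K (x - y) f(y) dy` over `ℝⁿ`. -/
noncomputable def leniaConv {n : ℕ} (K f : EuclideanSpace ℝ (Fin n) → ℝ)
    (x : EuclideanSpace ℝ (Fin n)) : ℝ :=
  ∫ y, K (x - y) * f y

theorem aestronglyMeasurable_leniaConv {n : ℕ} {K f : EuclideanSpace ℝ (Fin n) → ℝ}
    (hK : AEStronglyMeasurable K volume) (hf : NullMeasurable f volume) :
    AEStronglyMeasurable (leniaConv K f) volume := by
  have h := hf.aemeasurable.aestronglyMeasurable.convolution_integrand
    (ContinuousLinearMap.mul ℝ ℝ) hK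
  have h2 := h.integral_prod_right'
  refine h2.congr (Eventually.of_forall fun x => ?_)
  simp [leniaConv, mul_comm]

/-- The Lenia arc field `X_t(f)(x) = [f(x) + t G((K ∗ f)(x))]₀¹`, where
`[u]₀¹ = min (max u 0) 1` is the clip to `[0,1]`, on `𝓑(ℝⁿ, [0,1])`. -/
noncomputable def leniaArcField {n : ℕ} {G : ℝ → ℝ} {K : EuclideanSpace ℝ (Fin n) → ℝ}
    (hG : Continuous G) (hK : Integrable K volume) (t : ℝ≥0) (f : LeniaState n) :
    LeniaState n where
  toFun x := min (max (f x + t * G (leniaConv K f x)) 0) 1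
  nullMeasurable' := by
    have h1 : AEMeasurable f volume := f.nullMeasurable'.aemeasurable
    have h2 : AEMeasurable (fun x => G (leniaConv K f x)) volume :=
      (hG.comp_aestronglyMeasurable
        (aestronglyMeasurable_leniaConv hK.1 f.nullMeasurable')).aemeasurable
    exact (((h1.add (h2.const_mul (t : ℝ))).max aemeasurable_const).min
      aemeasurable_const).nullMeasurable
  mem_Icc' x := ⟨le_min (le_max_right _ _) zero_le_one, min_le_right _ _⟩

/-- `F` is the Lenia flow with activation function `G` and kernel `K`: the forward flow on
`𝓑(ℝⁿ, [0,1])` that is forward tangent to the Lenia arc field. The Lenia solution with initial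
condition `f₀` is `f_t = F t f₀`. -/
structure IsLeniaFlow {n : ℕ} {G : ℝ → ℝ} {K : EuclideanSpace ℝ (Fin n) → ℝ}
    (hG : Continuous G) (hK : Integrable K volume)
    (F : ℝ≥0 → LeniaState n → LeniaState n) : Prop where
  isForwardFlow : IsForwardFlow F
  isForwardTangent : IsForwardTangent F (leniaArcField hG hK)

/-! The value of a solution at a point grows at rate at most `g`. Hence, if `u_p` vanishes on the
ball `B(x, R)`, then `u ≤ g τ` there during `[p, p + τ]`, so that `|K ∗ u| ≤ g τ ‖K‖₁` at `x`. As
long as this is at most `a`, the growth rate at `x` is `G (K ∗ u) ≤ 0` and `u` remains zero at `x`.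
Thus the support moves by less than `R` in time `τ`. A time `t ≤ a k / (g ‖K‖₁)` is divided into `k`
such steps, in which the support moves by less than `k R`. -/

/-- Solutions of an arc field `X` on a metric space: continuous curves that are forward tangent
to `X`. The trajectories of a forward flow tangent to `X` are solutions. -/
structure IsArcFieldSolution {M : Type*} [PseudoMetricSpace M] (X : ℝ≥0 → M → M) (u : ℝ≥0 → M) :
    Prop where
  continuous : Continuous u
  tangent (t : ℝ≥0) :
    Tendsto (fun h : ℝ≥0 => dist (u (t + h)) (X h (u t)) / (h : ℝ)) (𝓝[>] 0) (𝓝 0)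

theorem IsLeniaFlow.isArcFieldSolution {n : ℕ} {G : ℝ → ℝ} {K : EuclideanSpace ℝ (Fin n) → ℝ}
    {hG : Continuous G} {hK : Integrable K volume} {F : ℝ≥0 → LeniaState n → LeniaState n}
    (hF : IsLeniaFlow hG hK F) (f : LeniaState n) :
    IsArcFieldSolution (leniaArcField hG hK) (fun t => F t f) where
  continuous := hF.isForwardFlow.continuous.comp (continuous_id.prodMk continuous_const)
  tangent t := hF.isForwardTangent t f

theorem le_add_mul_of_frequently_lt_add_mul {v : ℝ≥0 → ℝ} {p q : ℝ≥0} (hpq : p ≤ q)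
    (hv : ContinuousOn v (Set.Icc p q)) {c : ℝ}
    (hslope : ∀ s, p ≤ s → s < q → ∀ r > c,
      ∃ᶠ h : ℝ≥0 in 𝓝[>] 0, v (s + h) < v s + r * h) :
    v q ≤ v p + c * (q - p) := by
  have hcont : ContinuousOn (fun s : ℝ => v s.toNNReal) (Set.Icc (p : ℝ) q) :=
    hv.comp continuous_real_toNNReal.continuousOn fun s hs =>
      ⟨NNReal.le_toNNReal_of_coe_le hs.1, Real.toNNReal_le_iff_le_coe.mpr hs.2⟩
  have hderiv (s : ℝ) : HasDerivAt (fun s => v p + c * (s - p)) c s := by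
    simpa using (((hasDerivAt_id s).sub_const (p : ℝ)).const_mul c).const_add (v p)
  suffices ∀ s ∈ Set.Ico (p : ℝ) q, ∀ r, c < r →
      ∃ᶠ z in 𝓝[>] s, slope (fun s : ℝ => v s.toNNReal) s z < r by
    simpa using image_le_of_liminf_slope_right_le_deriv_boundary hcont (by simp)
      (fun s _ => (hderiv s).continuousAt.continuousWithinAt)
      (fun s _ => (hderiv s).hasDerivWithinAt) this
      (Set.right_mem_Icc.mpr (NNReal.coe_le_coe.mpr hpq))
  rintro s ⟨hps, hsq⟩ r hr
  lift s to ℝ≥0 using p.coe_nonneg.trans hps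
  have htendsto : Tendsto (fun h : ℝ≥0 => (s : ℝ) + h) (𝓝[>] 0) (𝓝[>] (s : ℝ)) := by
    refine tendsto_nhdsWithin_iff.mpr ⟨?_, ?_⟩
    · exact (Continuous.tendsto' (by fun_prop) _ _ (by simp)).mono_left nhdsWithin_le_nhds
    · filter_upwards [self_mem_nhdsWithin] with h hh
      simpa using hh
  have hfreq := (hslope s (by exact_mod_cast hps) (by exact_mod_cast hsq) r hr).and_eventually
    self_mem_nhdsWithin
  refine htendsto.frequently (hfreq.mono fun h ⟨hlt, hh⟩ => ?_)
  have hh' : (0 : ℝ) < h := NNReal.coe_pos.mpr hh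
  rw [slope_def_field, add_sub_cancel_left, div_lt_iff₀ hh', ← NNReal.coe_add,
    Real.toNNReal_coe, Real.toNNReal_coe]
  exact sub_left_lt_of_lt_add hlt

namespace IsArcFieldSolution

variable {M : Type*} [PseudoMetricSpace M] {X : ℝ≥0 → M → M} {u : ℝ≥0 → M} {L : ℝ≥0} {φ : M → ℝ}
  {c : ℝ}

theorem eventually_lt_add_mul (hu : IsArcFieldSolution X u) (hφ : LipschitzWith L φ) {s : ℝ≥0}
    (hX : ∀ᶠ h : ℝ≥0 in 𝓝[>] 0, φ (X h (u s)) ≤ φ (u s) + c * h) {r : ℝ} (hr : c < r) :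
    ∀ᶠ h : ℝ≥0 in 𝓝[>] 0, φ (u (s + h)) < φ (u s) + r * h := by
  have hdist : ∀ᶠ h : ℝ≥0 in 𝓝[>] 0, L * (dist (u (s + h)) (X h (u s)) / h) < r - c := by
    refine ((hu.tangent s).const_mul (L : ℝ)).eventually_lt_const ?_
    simpa using hr
  filter_upwards [hX, hdist, self_mem_nhdsWithin] with h hXh hdisth hh
  have hh' : (0 : ℝ) < h := NNReal.coe_pos.mpr hh
  rw [mul_div_assoc', div_lt_iff₀ hh'] at hdisth
  calc φ (u (s + h)) ≤ φ (X h (u s)) + L * dist (u (s + h)) (X h (u s)) :=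
        hφ.le_add_mul _ _
    _ < φ (u s) + c * h + (r - c) * h := add_lt_add_of_le_of_lt hXh hdisth
    _ = φ (u s) + r * h := by ring

theorem le_add_mul (hu : IsArcFieldSolution X u) (hφ : LipschitzWith L φ) {p q : ℝ≥0}
    (hpq : p ≤ q)
    (hX : ∀ s, p ≤ s → s < q → ∀ᶠ h : ℝ≥0 in 𝓝[>] 0, φ (X h (u s)) ≤ φ (u s) + c * h) :
    φ (u q) ≤ φ (u p) + c * (q - p) :=
  le_add_mul_of_frequently_lt_add_mul (v := φ ∘ u) hpq
    (hφ.continuous.comp hu.continuous).continuousOn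
    fun s hps hsq _ hr => (hu.eventually_lt_add_mul hφ (hX s hps hsq) hr).frequently

end IsArcFieldSolution

section Lenia

variable {n : ℕ}

theorem LeniaState.lipschitzWith_apply (x : EuclideanSpace ℝ (Fin n)) :
    LipschitzWith 1 fun f : LeniaState n => f x :=
  LipschitzWith.of_dist_le_mul fun f g => by
    simpa [Real.dist_eq, LeniaState.dist_def] using le_ciSup (LeniaState.bddAbove_abs_sub f g) x

theorem leniaConv_eq_convolution (K f : EuclideanSpace ℝ (Fin n) → ℝ) :
    leniaConv K f = convolution K f (ContinuousLinearMap.mul ℝ ℝ) volume :=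
  funext fun _ => convolution_mul_swap.symm

variable {G : ℝ → ℝ} {K : EuclideanSpace ℝ (Fin n) → ℝ}

theorem abs_leniaConv_le {f : EuclideanSpace ℝ (Fin n) → ℝ} (hK : Integrable K volume)
    {R : ℝ} (hKR : Function.support K ⊆ Metric.ball 0 R)
    (hf : AEStronglyMeasurable f volume) (x : EuclideanSpace ℝ (Fin n)) {c : ℝ} (hc : 0 ≤ c)
    (hfc : ∀ y ∈ Metric.ball x R, |f y| ≤ c) :
    |leniaConv K f x| ≤ c * ∫ y, ‖K y‖ := by
  have h := dist_convolution_le' (L := ContinuousLinearMap.mul ℝ ℝ) (z₀ := (0 : ℝ)) hc hK hKR hf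
    (by simpa using hfc)
  simpa [leniaConv_eq_convolution, mul_comm] using h

variable {hG : Continuous G} {hK : Integrable K volume}

theorem leniaArcField_apply_le {f : LeniaState n} {x : EuclideanSpace ℝ (Fin n)} {c : ℝ}
    (hc : 0 ≤ c) (hGc : G (leniaConv K f x) ≤ c) (h : ℝ≥0) :
    leniaArcField hG hK h f x ≤ f x + c * h := by
  refine (min_le_left _ _).trans (max_le ?_ ?_)
  · rw [mul_comm c]
    gcongr
  · exact add_nonneg (f.mem_Icc' x).1 (by positivity)

namespace IsArcFieldSolution

variable {u : ℝ≥0 → LeniaState n}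

theorem apply_le_add_mul (hu : IsArcFieldSolution (leniaArcField hG hK) u)
    {x : EuclideanSpace ℝ (Fin n)} {p q : ℝ≥0} (hpq : p ≤ q) {c : ℝ} (hc : 0 ≤ c)
    (hGc : ∀ s, p ≤ s → s < q → G (leniaConv K (u s) x) ≤ c) :
    u q x ≤ u p x + c * (q - p) :=
  hu.le_add_mul (LeniaState.lipschitzWith_apply x) hpq fun s hps hsq =>
    Eventually.of_forall (leniaArcField_apply_le hc (hGc s hps hsq))

variable {a g R : ℝ}

theorem abs_leniaConv_le_of_eq_zero_on_ball (hu : IsArcFieldSolution (leniaArcField hG hK) u)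
    (hg : 0 ≤ g) (hGg : ∀ v, G v ≤ g) (hKR : Function.support K ⊆ Metric.ball 0 R)
    {x : EuclideanSpace ℝ (Fin n)} {p s : ℝ≥0} (hps : p ≤ s)
    (hball : ∀ y ∈ Metric.ball x R, u p y = 0) :
    |leniaConv K (u s) x| ≤ g * (s - p) * ∫ y, ‖K y‖ := by
  have hps' : (0 : ℝ) ≤ s - p := sub_nonneg.mpr (NNReal.coe_le_coe.mpr hps)
  refine abs_leniaConv_le hK hKR (u s).nullMeasurable'.aemeasurable.aestronglyMeasurable x
    (by positivity) fun y hy => ?_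
  rw [abs_of_nonneg ((u s).mem_Icc' y).1]
  simpa [hball y hy] using hu.apply_le_add_mul (x := y) hps hg fun _ _ _ => hGg _

theorem support_add_subset_thickening (hu : IsArcFieldSolution (leniaArcField hG hK) u)
    (hGa : ∀ v, |v| ≤ a → G v ≤ 0) (hg : 0 ≤ g) (hGg : ∀ v, G v ≤ g) (hR : 0 < R)
    (hKR : Function.support K ⊆ Metric.ball 0 R) {τ : ℝ≥0} (hτ : g * τ * ∫ y, ‖K y‖ ≤ a)
    (p : ℝ≥0) :
    Function.support (u (p + τ)) ⊆ Metric.thickening R (Function.support (u p)) := by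
  intro x hx
  by_contra hxR
  have hball : ∀ y ∈ Metric.ball x R, u p y = 0 := fun y hy =>
    Function.notMem_support.mp fun hyu =>
      hxR (Metric.mem_thickening_iff.mpr ⟨y, hyu, Metric.mem_ball'.mp hy⟩)
  have hrate : ∀ s, p ≤ s → s < p + τ → G (leniaConv K (u s) x) ≤ 0 := fun s hps hsτ => by
    have hsτ' : (s : ℝ) - p ≤ τ := sub_le_iff_le_add'.mpr (by exact_mod_cast hsτ.le)
    refine hGa _ ((hu.abs_leniaConv_le_of_eq_zero_on_ball hg hGg hKR hps hball).trans
      (le_trans ?_ hτ))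
    gcongr
  refine hx (le_antisymm ?_ ((u (p + τ)).mem_Icc' x).1)
  simpa [hball x (Metric.mem_ball_self hR)] using
    hu.apply_le_add_mul (x := x) le_self_add le_rfl hrate

theorem support_subset_thickening_of_mul_le (hu : IsArcFieldSolution (leniaArcField hG hK) u)
    (hGa : ∀ v, |v| ≤ a → G v ≤ 0) (hg : 0 ≤ g) (hGg : ∀ v, G v ≤ g) (hR : 0 < R)
    (hKR : Function.support K ⊆ Metric.ball 0 R) {k : ℕ} (hk : 0 < k) {t : ℝ≥0}
    (ht : g * t * ∫ y, ‖K y‖ ≤ k * a) :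
    Function.support (u t) ⊆ Metric.thickening (k * R) (Function.support (u 0)) := by
  have hk' : (0 : ℝ) < k := Nat.cast_pos.mpr hk
  have hτ : g * (t / k : ℝ≥0) * ∫ y, ‖K y‖ ≤ a := by
    refine le_of_mul_le_mul_left (le_of_eq_of_le ?_ ht) hk'
    push_cast
    field_simp
  have hstep := hu.support_add_subset_thickening hGa hg hGg hR hKR hτ
  have hiter : ∀ j : ℕ, 1 ≤ j → Function.support (u (j * (t / k))) ⊆
      Metric.thickening (j * R) (Function.support (u 0)) := fun j hj => by
    induction j, hj using Nat.le_induction with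
    | base => simpa using hstep 0
    | succ j _ ih =>
      push_cast
      rw [add_one_mul, add_one_mul, add_comm (j * R)]
      exact (hstep _).trans ((Metric.thickening_subset_of_subset R ih).trans
        (Metric.thickening_thickening_subset _ _ _))
  simpa [mul_div_cancel₀ t (Nat.cast_ne_zero.mpr hk.ne' : (k : ℝ≥0) ≠ 0)] using hiter k hk

end IsArcFieldSolution

end Lenia

theorem exists_nat_mul_le_of_le_mul_div {m : ℕ∞} {a b t : ℝ≥0∞} (ha : a ≠ 0) (hb : b ≠ ⊤)
    (ht₀ : t ≠ 0) (ht : t ≠ ⊤) (h : t ≤ a * m / b) :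
    ∃ k : ℕ, 0 < k ∧ (k : ℕ∞) ≤ m ∧ t * b ≤ k * a := by
  induction m using ENat.recTopCoe with
  | top =>
    obtain ⟨k, hk⟩ := ENNReal.exists_nat_mul_gt ha (ENNReal.mul_ne_top ht hb)
    refine ⟨k, Nat.pos_of_ne_zero ?_, le_top, hk.le⟩
    rintro rfl
    simp at hk
  | coe k =>
    refine ⟨k, Nat.pos_of_ne_zero ?_, le_rfl, ?_⟩
    · rintro rfl
      exact ht₀ (by simpa using h)
    · simpa [mul_comm] using ENNReal.mul_le_of_le_div h

theorem natCast_mul_le_of_le_floor_div {k : ℕ} {d : ℝ≥0∞} {R : ℝ}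
    (hk : (k : ℕ∞) ≤ ⌊d / ENNReal.ofReal R⌋ₑ) : ENNReal.ofReal (k * R) ≤ d := by
  rw [ENNReal.ofReal_mul k.cast_nonneg, ENNReal.ofReal_natCast]
  exact ENNReal.mul_le_of_le_div (by simpa using ENat.le_floor.mp hk)

theorem mainTheorem5_general {n : ℕ} {G : ℝ → ℝ} {K : EuclideanSpace ℝ (Fin n) → ℝ}
    {hG : Continuous G} {hK : Integrable K volume} {u : ℝ≥0 → LeniaState n}
    (hu : IsArcFieldSolution (leniaArcField hG hK) u)
    {a : ℝ} (ha : 0 < a) (hGa : ∀ v : ℝ, |v| ≤ a → G v ≤ 0)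
    {g : ℝ} (hg : 0 < g) (hGg : ∀ v : ℝ, G v ≤ g)
    {R : ℝ} (hR : 0 < R) (hKR : Function.support K ⊆ Metric.ball 0 R)
    {x : EuclideanSpace ℝ (Fin n)} {t : ℝ≥0} (ht : 0 < t)
    (htx : (t : ℝ≥0∞) ≤
      ENNReal.ofReal a * ((⌊Metric.infEDist x (tsupport (u 0)) / ENNReal.ofReal R⌋ₑ : ℕ∞) : ℝ≥0∞)
        / (ENNReal.ofReal g * eLpNorm K 1 volume)) :
    u t x = 0 := by
  have hnorm : eLpNorm K 1 volume = ENNReal.ofReal (∫ y, ‖K y‖) := by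
    rw [eLpNorm_one_eq_lintegral_enorm, ofReal_integral_norm_eq_lintegral_enorm hK]
  rw [hnorm, ← ENNReal.ofReal_mul hg.le] at htx
  obtain ⟨k, hk, hkd, hkt⟩ := exists_nat_mul_le_of_le_mul_div (ENNReal.ofReal_pos.mpr ha).ne'
    ENNReal.ofReal_ne_top (ENNReal.coe_pos.mpr ht).ne' ENNReal.coe_ne_top htx
  have hkt' : g * t * ∫ y, ‖K y‖ ≤ k * a := by
    rw [← ENNReal.ofReal_coe_nnreal, ← ENNReal.ofReal_natCast, ← ENNReal.ofReal_mul t.coe_nonneg,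
      ← ENNReal.ofReal_mul k.cast_nonneg, ENNReal.ofReal_le_ofReal_iff (by positivity)] at hkt
    linarith
  by_contra hx
  have hxk : Metric.infEDist x (Function.support (u 0)) < ENNReal.ofReal (k * R) :=
    hu.support_subset_thickening_of_mul_le hGa hg.le hGg hR hKR hk hkt' hx
  rw [tsupport, Metric.infEDist_closure] at hkd
  exact hxk.not_ge (natCast_mul_le_of_le_floor_div hkd)

/-- The distance `d(x)` from `x` to `supp f₀` is taken in `[0, ∞]`, so it is `∞` when `f₀ = 0`; the
bound on `t` is likewise computed in `[0, ∞]`, with `k / 0 = ∞` for `k > 0` and `0 / 0 = 0`. -/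
theorem mainTheorem5 (n : ℕ) (G : ℝ → ℝ) (K : EuclideanSpace ℝ (Fin n) → ℝ)
    (C : ℝ≥0) (hG : LipschitzWith C G) (hGbdd : ∃ B : ℝ, ∀ u, |G u| ≤ B)
    (hK : Integrable K volume)
    (F : ℝ≥0 → LeniaState n → LeniaState n) (hF : IsLeniaFlow hG.continuous hK F)
    (a : ℝ) (ha : 0 < a) (hGa : ∀ u : ℝ, |u| ≤ a → G u ≤ 0)
    (g : ℝ) (hg : 0 < g) (hGg : ∀ u : ℝ, G u ≤ g)
    (R : ℝ) (hR : 0 < R) (hKR : Function.support K ⊆ Metric.ball 0 R)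
    (f₀ : LeniaState n) (x : EuclideanSpace ℝ (Fin n)) (t : ℝ≥0) (ht : 0 < t)
    (htx : (t : ℝ≥0∞) ≤
      ENNReal.ofReal a * ((⌊Metric.infEDist x (tsupport f₀) / ENNReal.ofReal R⌋ₑ : ℕ∞) : ℝ≥0∞)
        / (ENNReal.ofReal g * eLpNorm K 1 volume)) :
    F t f₀ x = 0 :=
  mainTheorem5_general (hF.isArcFieldSolution f₀) ha hGa hg hGg hR hKR ht
    (by rwa [hF.isForwardFlow.zero])
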